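/- Let $\mathbb K\in\{\mathbb R,\mathbb C\}$, let $J,R,Q\in\mathbb K^{n\times n}$ with $J=-J^H$, $R=R^H\ge 0$, $Q=Q^H\ge 0$, let $B\in\mathbb K^{n\times m}$, and let $S\in\mathbb K^{m\times m}$ with $S=S^H\ge 0$. Put $A:=(J-R)Q$ and $$\mathcal E:=\begin{bmatrix}0&I_n&0\\-I_n&0&0\\0&0&0\end{bmatrix},\qquad \mathcal A_S:=\begin{bmatrix}0&A&B\\A^H&QRQ&0\\B^H&0&S\end{bmatrix}\in\mathbb K^{(2n+m)\times(2n+m)},$$ and assume that the pencil $s\mathcal E-\mathcal A_S$ is regular, i.e. $\det(s\mathcal E-\mathcal A_S)$ is not the zero polynomial. Let $\mu\in\mathbb K\setminus(\sigma(A)\cup\sigma(-A^H))$ be such that $\mu\mathcal E-\mathcal A_S$ is invertible, and define $$E_\mu:=\begin{bmatrix}0&A-\mu I\\A^H+\mu I&QRQ\end{bmatrix}^{-1},\qquad S_\mu:=S-\begin{bmatrix}B^H&0\end{bmatrix}E_\mu\begin{bmatrix}B\\0\end{bmatrix},$$ $$N_\mu:=\left(E_\mu+E_\mu\begin{bmatrix}B\\0\end{bmatrix}S_\mu^{-1}\begin{bmatrix}B^H&0\end{bmatrix}E_\mu\right)\begin{bmatrix}0&-I\\I&0\end{bmatrix},\qquad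 M_\mu:=-S_\mu^{-1}\begin{bmatrix}B^H&0\end{bmatrix}E_\mu\begin{bmatrix}0&-I\\I&0\end{bmatrix}.$$ For a square matrix $M$ let $M^D$ denote its Drazin inverse, i.e. the unique matrix with $M^DM=MM^D$, $M^DMM^D=M^D$ and $M^DM^{\nu+1}=M^\nu$ for some $\nu\in\mathbb N_0$. Let $t_0<t_1$ and let $(\lambda,x,u)\in\mathcal C^1([t_0,t_1],\mathbb K^{n+n+m})$, meaning the restriction to $[t_0,t_1]$ of a $\mathcal C^1$ function on a larger open interval. Then $(\lambda,x,u)$ solves the optimality DAE $$\frac{\mathrm d}{\mathrm dt}\,\mathcal E\begin{bmatrix}\lambda\\x\\u\end{bmatrix}=\mathcal A_S\begin{bmatrix}\lambda\\x\\u\end{bmatrix}\quad\text{on }[t_0,t_1]$$ if and only if $\begin{bmatrix}\lambda(t_0)\\x(t_0)\end{bmatrix}\in\operatorname{im}(N_\mu^DN_\mu)$ and, for all $t\in[t_0,t_1]$, $$\begin{bmatrix}\lambda(t)\\x(t)\end{bmatrix}=\exp\!\big(-N_\mu^D(I-\mu N_\mu)(t-t_0)\big)\begin{bmatrix}\lambda(t_0)\\x(t_0)\end{bmatrix},\qquad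 u(t)=M_\mu N_\mu^D\begin{bmatrix}\lambda(t)\\x(t)\end{bmatrix}.$$ -/

import Mathlib

open Matrix Polynomial Set
open scoped ComplexOrder

/-- `X` satisfies the three defining properties of the Drazin inverse of `M`. -/
structure IsDrazinInverse {ι 𝕜 : Type*} [Fintype ι] [DecidableEq ι] [Field 𝕜]
    (M X : Matrix ι ι 𝕜) : Prop where
  comm : X * M = M * X
  idem : X * M * X = X
  pow : ∃ ν : ℕ, X * M ^ (ν + 1) = M ^ ν

theorem exists_isDrazinInverse {ι 𝕜 : Type*} [Fintype ι] [DecidableEq ι] [Field 𝕜]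
    (M : Matrix ι ι 𝕜) : ∃ X, IsDrazinInverse M X := by
  have hp : minpoly 𝕜 M ≠ 0 := minpoly.ne_zero (Algebra.IsIntegral.isIntegral M)
  obtain ⟨q, hq, hXq⟩ := exists_eq_pow_rootMultiplicity_mul_and_not_dvd (minpoly 𝕜 M) hp 0
  set k := rootMultiplicity 0 (minpoly 𝕜 M)
  rw [C_0, sub_zero] at hq hXq
  obtain ⟨a, b, hab⟩ := (irreducible_X (R := 𝕜)).coprime_iff_not_dvd.2 hXq
  set α := aeval M a with hα
  have hc : Commute M α := by
    have := Commute.all (X : 𝕜[X]) a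
    simpa using this.map (aeval M)
  have h1 : M ^ k = α * M ^ (k + 1) := by
    have : (X : 𝕜[X]) ^ k = a * X ^ (k + 1) + b * minpoly 𝕜 M := by
      rw [hq]; linear_combination (-(X : 𝕜[X]) ^ k) * hab
    simpa using congrArg (aeval M) this
  have hcp : ∀ i j, Commute (M ^ i) (α ^ j) := fun i j => hc.pow_pow i j
  have h2 : ∀ j, M ^ k = α ^ j * M ^ (k + j) := by
    intro j
    induction j with
    | zero => simp
    | succ j ih =>
      calc M ^ k = α ^ j * (M ^ k * M ^ j) := by rw [← pow_add]; exact ih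
        _ = α ^ j * (α * M ^ (k + 1) * M ^ j) := by rw [← h1]
        _ = α ^ (j + 1) * M ^ (k + (j + 1)) := by
          rw [pow_succ α j, show k + (j + 1) = (k + 1) + j by ring, pow_add M (k + 1) j]
          simp only [mul_assoc]
  have h3 : α ^ (k + 1) * M ^ k * M ^ (k + 1) = M ^ k := by
    rw [mul_assoc, ← pow_add, ← h2]
  refine ⟨α ^ (k + 1) * M ^ k, ?_, ?_, k, h3⟩
  · rw [mul_assoc, ← pow_succ, ← mul_assoc, (show M * α ^ (k + 1) = α ^ (k + 1) * M from
      (hc.pow_right _).eq), mul_assoc, ← pow_succ']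
  · calc α ^ (k + 1) * M ^ k * M * (α ^ (k + 1) * M ^ k)
        = α ^ (k + 1) * (M ^ (k + 1) * α ^ (k + 1)) * M ^ k := by
          rw [pow_succ M k]; simp only [mul_assoc]
      _ = α ^ (k + 1) * (α ^ (k + 1) * M ^ k * M ^ (k + 1)) := by
          rw [(hcp (k + 1) (k + 1)).eq]
          simp only [mul_assoc, ← pow_add, add_comm k (k + 1)]
      _ = α ^ (k + 1) * M ^ k := by rw [h3]

theorem IsDrazinInverse.unique {ι 𝕜 : Type*} [Fintype ι] [DecidableEq ι] [Field 𝕜]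
    {M X Y : Matrix ι ι 𝕜} (hX : IsDrazinInverse M X) (hY : IsDrazinInverse M Y) : X = Y := by
  have key : ∀ {Z : Matrix ι ι 𝕜}, IsDrazinInverse M Z →
      (∀ j, Z = Z ^ (j + 1) * M ^ j) ∧ ∃ ν, ∀ l, ν ≤ l → ∀ j, Z ^ j * M ^ (l + j) = M ^ l := by
    intro Z hZ
    refine ⟨fun j => ?_, ?_⟩
    · induction j with
      | zero => simp
      | succ j ih =>
        have h : Z = Z * (Z * M) := by
          rw [hZ.comm, ← mul_assoc]; exact hZ.idem.symm
        calc Z = Z * (Z * M) := h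
          _ = Z ^ (j + 1) * M ^ j * (Z * M) := by rw [← ih]
          _ = Z ^ (j + 1) * (M ^ j * Z) * M := by simp only [mul_assoc]
          _ = Z ^ (j + 1 + 1) * M ^ (j + 1) := by
            rw [← ((show Commute Z M from hZ.comm).pow_right j).eq, pow_succ Z (j + 1),
              pow_succ M j]
            simp only [mul_assoc]
    · obtain ⟨ν, hν⟩ := hZ.pow
      have hstep : ∀ l, ν ≤ l → Z * M ^ (l + 1) = M ^ l := by
        intro l hl
        obtain ⟨d, rfl⟩ := Nat.exists_eq_add_of_le hl
        rw [show ν + d + 1 = (ν + 1) + d by ring, pow_add, ← mul_assoc, hν, ← pow_add]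
      refine ⟨ν, fun l hl j => ?_⟩
      induction j with
      | zero => simp
      | succ j ih =>
        rw [pow_succ, mul_assoc, ← add_assoc, hstep _ (by omega), ih]
  obtain ⟨hX1, ν₁, hX2⟩ := key hX
  obtain ⟨hY1, ν₂, hY2⟩ := key hY
  set k := max ν₁ ν₂
  have hYk : M ^ (k + (k + 1)) * Y ^ (k + 1) = M ^ k := by
    rw [← ((show Commute Y M from hY.comm).pow_pow (k + 1) (k + (k + 1))).eq]
    exact hY2 k (le_max_right _ _) (k + 1)
  calc X = X ^ (k + 1) * M ^ k := hX1 k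
    _ = X ^ (k + 1) * M ^ (k + (k + 1)) * Y ^ (k + 1) := by rw [mul_assoc, hYk]
    _ = M ^ k * Y ^ (k + 1) := by rw [hX2 k (le_max_left _ _)]
    _ = Y ^ (k + 1) * M ^ k :=
      ((show Commute Y M from hY.comm).pow_pow (k + 1) k).eq.symm
    _ = Y := (hY1 k).symm

/-- The Drazin inverse of a square matrix. -/
noncomputable def drazinInverse {ι 𝕜 : Type*} [Fintype ι] [DecidableEq ι] [Field 𝕜]
    (M : Matrix ι ι 𝕜) : Matrix ι ι 𝕜 :=
  Classical.choose (exists_isDrazinInverse M)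

theorem isDrazinInverse_drazinInverse {ι 𝕜 : Type*} [Fintype ι] [DecidableEq ι] [Field 𝕜]
    (M : Matrix ι ι 𝕜) : IsDrazinInverse M (drazinInverse M) :=
  Classical.choose_spec (exists_isDrazinInverse M)

/-- The pencil `s E - A` is regular: its determinant is a nonzero polynomial in `s`. -/
def IsRegularPencil {ι 𝕜 : Type*} [Fintype ι] [DecidableEq ι] [Field 𝕜]
    (E A : Matrix ι ι 𝕜) : Prop :=
  ((X : 𝕜[X]) • E.map C - A.map C).det ≠ 0

/-- `f` restricts on `[t₀, t₁]` to a `C¹` function defined on a larger open interval. -/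
def IsC1OnInterval {F : Type*} [NormedAddCommGroup F] [NormedSpace ℝ F]
    (t₀ t₁ : ℝ) (f : ℝ → F) : Prop :=
  ∃ ε > 0, ∃ g : ℝ → F, ContDiffOn ℝ 1 g (Ioo (t₀ - ε) (t₁ + ε)) ∧ EqOn f g (Icc t₀ t₁)

/-- `z` solves `d/dt (E z) = A z` on `[t₀, t₁]` (one-sided derivatives at the end points). -/
def IsDAESolution {ι 𝕜 : Type*} [Fintype ι] [RCLike 𝕜]
    (E A : Matrix ι ι 𝕜) (t₀ t₁ : ℝ) (z : ℝ → ι → 𝕜) : Prop :=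
  ∀ t ∈ Icc t₀ t₁, HasDerivWithinAt (fun s => E *ᵥ z s) (A *ᵥ z t) (Icc t₀ t₁) t

namespace OptimalityDAE

section

variable {𝕜 : Type*} [RCLike 𝕜] {n m : ℕ}

/-- Membership of `(J, R, Q, B)` in the class of port-Hamiltonian systems; `B` is arbitrary. -/
structure IsPortHamiltonian (J R Q : Matrix (Fin n) (Fin n) 𝕜)
    (_B : Matrix (Fin n) (Fin m) 𝕜) : Prop where
  skew : J = -Jᴴ
  dissipation : R.PosSemidef
  energy : Q.PosSemidef

/-- The descriptor matrix `𝓔`, on block vectors `((λ, x), u)`. -/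
def calE (𝕜 : Type*) [RCLike 𝕜] (n m : ℕ) :
    Matrix ((Fin n ⊕ Fin n) ⊕ Fin m) ((Fin n ⊕ Fin n) ⊕ Fin m) 𝕜 :=
  fromBlocks (fromBlocks 0 1 (-1) 0) 0 0 0

/-- The coefficient matrix `𝓐_S`, on block vectors `((λ, x), u)`. -/
def calA (J R Q : Matrix (Fin n) (Fin n) 𝕜) (B : Matrix (Fin n) (Fin m) 𝕜)
    (S : Matrix (Fin m) (Fin m) 𝕜) :
    Matrix ((Fin n ⊕ Fin n) ⊕ Fin m) ((Fin n ⊕ Fin n) ⊕ Fin m) 𝕜 :=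
  fromBlocks (fromBlocks 0 ((J - R) * Q) ((J - R) * Q)ᴴ (Q * R * Q))
    (fromRows B 0) (fromCols Bᴴ 0) S

/-- The matrix `E_μ`. -/
noncomputable def Emu (J R Q : Matrix (Fin n) (Fin n) 𝕜) (μ : 𝕜) :
    Matrix (Fin n ⊕ Fin n) (Fin n ⊕ Fin n) 𝕜 :=
  (fromBlocks 0 ((J - R) * Q - μ • 1) (((J - R) * Q)ᴴ + μ • 1) (Q * R * Q))⁻¹

/-- The matrix `S_μ`. -/
noncomputable def Smu (J R Q : Matrix (Fin n) (Fin n) 𝕜) (B : Matrix (Fin n) (Fin m) 𝕜)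
    (S : Matrix (Fin m) (Fin m) 𝕜) (μ : 𝕜) : Matrix (Fin m) (Fin m) 𝕜 :=
  S - (fromCols Bᴴ 0 : Matrix (Fin m) (Fin n ⊕ Fin n) 𝕜) * Emu J R Q μ *
    (fromRows B 0 : Matrix (Fin n ⊕ Fin n) (Fin m) 𝕜)

/-- The matrix `N_μ`. -/
noncomputable def Nmu (J R Q : Matrix (Fin n) (Fin n) 𝕜) (B : Matrix (Fin n) (Fin m) 𝕜)
    (S : Matrix (Fin m) (Fin m) 𝕜) (μ : 𝕜) : Matrix (Fin n ⊕ Fin n) (Fin n ⊕ Fin n) 𝕜 :=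
  (Emu J R Q μ + Emu J R Q μ * (fromRows B 0 : Matrix (Fin n ⊕ Fin n) (Fin m) 𝕜) *
    (Smu J R Q B S μ)⁻¹ * (fromCols Bᴴ 0 : Matrix (Fin m) (Fin n ⊕ Fin n) 𝕜) * Emu J R Q μ) *
    fromBlocks 0 (-1) 1 0

/-- The matrix `M_μ`. The leading minus sign is the one for which `u = M_μ N_μ^D (λ, x)` holds:
for `J = R = 0`, `Q = B = S = 1` the optimality DAE forces `u = -λ`. -/
noncomputable def Mmu (J R Q : Matrix (Fin n) (Fin n) 𝕜) (B : Matrix (Fin n) (Fin m) 𝕜)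
    (S : Matrix (Fin m) (Fin m) 𝕜) (μ : 𝕜) : Matrix (Fin m) (Fin n ⊕ Fin n) 𝕜 :=
  -((Smu J R Q B S μ)⁻¹ * (fromCols Bᴴ 0 : Matrix (Fin m) (Fin n ⊕ Fin n) 𝕜) * Emu J R Q μ *
    fromBlocks 0 (-1) 1 0)

end

end OptimalityDAE

/-! Write `z = (λ, x)`. Subtracting `μ 𝓔 (z, u)` from both sides of the DAE leaves a system with
matrix `𝓐_S - μ 𝓔`, whose right-hand side involves only `z' - μ z` and vanishes in the last block
row. Its upper left block is invertible because `μ` avoids both spectra, and then so is the Schur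
complement `S_μ`. Block elimination (`blockSystem_iff`) turns the DAE, pointwise in `t`, into `z = N
(μ z - z')` and `u = M (μ z - z')`, where `N = N_μ` and `M = M_μ`.

With `D = N^D`, the matrix `D N` is a projection commuting with `N`, and `N` is nilpotent on its
kernel. Repeated differentiation shows that `z` has no component there
(`mulVec_eq_self_of_solution`). On the range, multiplying by `D` gives the ODE `z' = -D (1 - μ N)
z`, solved uniquely by the exponential; then `μ z - z' = D z`, which yields `u = M D z`. -/

/-- A block matrix with vanishing upper left block is invertible if its off-diagonal blocks are. -/
theorem isUnit_fromBlocks_zero₁₁ {ι 𝕜 : Type*} [Fintype ι] [DecidableEq ι] [Field 𝕜]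
    {X Y : Matrix ι ι 𝕜} (Z : Matrix ι ι 𝕜) (hX : IsUnit X) (hY : IsUnit Y) :
    IsUnit (fromBlocks 0 X Y Z) := by
  have hX' := (Matrix.isUnit_iff_isUnit_det X).1 hX
  have hY' := (Matrix.isUnit_iff_isUnit_det Y).1 hY
  -- Solve `X b = p`, `Y a + Z b = q` for `b`, then for `a`.
  refine IsUnit.of_mul_eq_one (fromBlocks (-(Y⁻¹ * Z * X⁻¹)) Y⁻¹ X⁻¹ 0) ?_
  rw [fromBlocks_multiply, ← fromBlocks_one]
  simp [← mul_assoc, mul_nonsing_inv _ hX', mul_nonsing_inv _ hY']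

/-- Block elimination: solving a `2 × 2` block system with right hand side `(w, 0)`
by means of the Schur complement of the upper left block. -/
theorem blockSystem_iff {ι κ 𝕜 : Type*} [Fintype ι] [DecidableEq ι] [Fintype κ] [DecidableEq κ]
    [Field 𝕜] {G : Matrix ι ι 𝕜} (b : Matrix ι κ 𝕜) (c : Matrix κ ι 𝕜) (S : Matrix κ κ 𝕜)
    (hG : IsUnit G) (hS : IsUnit (S - c * G⁻¹ * b)) (z w : ι → 𝕜) (u : κ → 𝕜) :
    (G *ᵥ z + b *ᵥ u = w ∧ c *ᵥ z + S *ᵥ u = 0) ↔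
      (z = (G⁻¹ + G⁻¹ * b * (S - c * G⁻¹ * b)⁻¹ * c * G⁻¹) *ᵥ w ∧
        u = -(((S - c * G⁻¹ * b)⁻¹ * c * G⁻¹) *ᵥ w)) := by
  have hG' := (Matrix.isUnit_iff_isUnit_det G).1 hG
  have hS' := (Matrix.isUnit_iff_isUnit_det _).1 hS
  have key : ∀ u, c *ᵥ G⁻¹ *ᵥ (w - b *ᵥ u) + S *ᵥ u =
      c *ᵥ G⁻¹ *ᵥ w + (S - c * G⁻¹ * b) *ᵥ u := by
    intro u
    simp only [mulVec_sub, sub_mulVec, mulVec_mulVec, Matrix.mul_assoc]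
    abel
  have hz : ∀ u, u = -(((S - c * G⁻¹ * b)⁻¹ * c * G⁻¹) *ᵥ w) →
      G⁻¹ *ᵥ (w - b *ᵥ u) = (G⁻¹ + G⁻¹ * b * (S - c * G⁻¹ * b)⁻¹ * c * G⁻¹) *ᵥ w := by
    rintro u rfl
    simp only [mulVec_add, mulVec_neg, add_mulVec, mulVec_mulVec, Matrix.mul_assoc,
      sub_neg_eq_add]
  constructor
  · rintro ⟨h1, h2⟩
    have h3 : z = G⁻¹ *ᵥ (w - b *ᵥ u) := by
      rw [← h1, add_sub_cancel_right, mulVec_mulVec, nonsing_inv_mul _ hG', one_mulVec]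
    have h4 : u = -(((S - c * G⁻¹ * b)⁻¹ * c * G⁻¹) *ᵥ w) := by
      rw [h3, key] at h2
      have := congrArg (fun v => (S - c * G⁻¹ * b)⁻¹ *ᵥ v) (eq_neg_of_add_eq_zero_right h2)
      simp only [mulVec_neg, mulVec_mulVec, nonsing_inv_mul _ hS', one_mulVec] at this
      exact this.trans (by rw [Matrix.mul_assoc _ c])
    exact ⟨h3.trans (hz u h4), h4⟩
  · rintro ⟨h1, h2⟩
    rw [← hz u h2] at h1
    constructor
    · rw [h1, mulVec_mulVec, mul_nonsing_inv _ hG', one_mulVec, sub_add_cancel]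
    · rw [h1, key, h2, mulVec_neg, mulVec_mulVec, mulVec_mulVec, Matrix.mul_assoc _ c, ← Matrix.mul_assoc (S - _),
        mul_nonsing_inv _ hS', Matrix.one_mul, add_neg_cancel]

/-! ### Linear initial value problems with constant coefficients -/

theorem HasDerivWithinAt.matrix_mulVec {ι κ 𝕜 : Type*} [Fintype ι] [Fintype κ] [RCLike 𝕜]
    (M : Matrix κ ι 𝕜) {z : ℝ → ι → 𝕜} {z' : ι → 𝕜} {s : Set ℝ} {t : ℝ}
    (h : HasDerivWithinAt z z' s t) : HasDerivWithinAt (fun r => M *ᵥ z r) (M *ᵥ z') s t :=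
  (LinearMap.toContinuousLinearMap
    (M.mulVecLin.restrictScalars ℝ)).hasFDerivAt.comp_hasDerivWithinAt t h

section

-- Differentiating the exponential needs a Banach algebra norm; in finite dimension the choice is
-- immaterial.
attribute [local instance] Matrix.linftyOpNormedRing Matrix.linftyOpNormedAlgebra

theorem hasDerivAt_exp_smul_mulVec {ι 𝕜 : Type*} [Fintype ι] [DecidableEq ι] [RCLike 𝕜]
    (L : Matrix ι ι 𝕜) (v : ι → 𝕜) (t₀ t : ℝ) :
    HasDerivAt (fun r : ℝ => NormedSpace.exp (((r - t₀ : ℝ) : 𝕜) • L) *ᵥ v)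
      (L *ᵥ NormedSpace.exp (((t - t₀ : ℝ) : 𝕜) • L) *ᵥ v) t := by
  have h := (hasDerivAt_exp_smul_const' (𝕂 := ℝ) L (t - t₀)).scomp t
    ((hasDerivAt_id t).sub_const t₀)
  have h2 := (LinearMap.toContinuousLinearMap
    (((Matrix.mulVecBilin 𝕜 𝕜).flip v : Matrix ι ι 𝕜 →ₗ[𝕜] ι → 𝕜).restrictScalars
      ℝ)).hasFDerivAt.comp_hasDerivAt t h
  have hL : ∀ r : ℝ, (r : 𝕜) • L = r • L := fun r => (RCLike.real_smul_eq_coe_smul r L).symm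
  simp only [hL, mulVec_mulVec]
  rw [one_smul] at h2
  exact h2

end

/-- Uniqueness for linear initial value problems on a compact interval. -/
theorem eq_exp_smul_mulVec_of_hasDerivWithinAt {ι 𝕜 : Type*} [Fintype ι] [DecidableEq ι]
    [RCLike 𝕜] (L : Matrix ι ι 𝕜) {z : ℝ → ι → 𝕜} {t₀ t₁ : ℝ}
    (h : ∀ t ∈ Icc t₀ t₁, HasDerivWithinAt z (L *ᵥ z t) (Icc t₀ t₁) t) :
    ∀ t ∈ Icc t₀ t₁, z t = NormedSpace.exp (((t - t₀ : ℝ) : 𝕜) • L) *ᵥ z t₀ := by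
  have hL := (LinearMap.toContinuousLinearMap (L.mulVecLin.restrictScalars ℝ)).lipschitz
  refine ODE_solution_unique (v := fun _ y => L *ᵥ y) (fun _ => hL)
    (fun t ht => (h t ht).continuousWithinAt)
    (fun t ht => (h t ⟨ht.1, ht.2.le⟩).mono_of_mem_nhdsWithin (Icc_mem_nhdsGE_of_mem ht))
    (fun t _ => (hasDerivAt_exp_smul_mulVec L (z t₀) t₀ t).continuousAt.continuousWithinAt)
    (fun t _ => (hasDerivAt_exp_smul_mulVec L (z t₀) t₀ t).hasDerivWithinAt) ?_
  simp

/-! ### Drazin inverses and the DAE `N z' = -(1 - μ N) z` -/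

section Drazin

variable {ι 𝕜 : Type*} [Fintype ι] [DecidableEq ι] [Field 𝕜] {N D : Matrix ι ι 𝕜}

theorem IsDrazinInverse.mem_range_iff (h : IsDrazinInverse N D) (v : ι → 𝕜) :
    v ∈ LinearMap.range (D * N).mulVecLin ↔ (D * N) *ᵥ v = v := by
  refine ⟨?_, fun hv => ⟨v, hv⟩⟩
  rintro ⟨w, rfl⟩
  rw [mulVecLin_apply, mulVec_mulVec, ← mul_assoc, h.idem]

/-- On the range of `D * N`, the slope `-D (1 - μ N)` solves `N y = -(1 - μ N) v`. -/
theorem IsDrazinInverse.mulVec_slope (h : IsDrazinInverse N D) (μ : 𝕜) {v : ι → 𝕜}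
    (hv : (D * N) *ᵥ v = v) :
    N *ᵥ (-(D * (1 - μ • N))) *ᵥ v = -((1 - μ • N) *ᵥ v) := by
  have hc : N * (D * (1 - μ • N)) = (1 - μ • N) * (D * N) := by
    have h' : N * D * N = D * N * N := by rw [h.comm]
    rw [← mul_assoc, ← h.comm, mul_sub, sub_mul, mul_one, one_mul, mul_smul_comm,
      smul_mul_assoc, ← h', mul_assoc N D N]
  rw [mulVec_mulVec, mul_neg, hc, neg_mulVec, ← mulVec_mulVec, hv]

end Drazin

section

variable {ι 𝕜 : Type*} [Fintype ι] [DecidableEq ι] [RCLike 𝕜] {N D : Matrix ι ι 𝕜}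
  {z z' : ℝ → ι → 𝕜} {t₀ t₁ : ℝ} {μ : 𝕜}

/-- A solution of `N z' = -(1 - μ N) z` has no component in the nilpotent part of `N`. -/
theorem IsDrazinInverse.mulVec_eq_self_of_solution (h : IsDrazinInverse N D) (ht : t₀ < t₁)
    (hz : ∀ t ∈ Icc t₀ t₁, HasDerivWithinAt z (z' t) (Icc t₀ t₁) t)
    (hN : ∀ t ∈ Icc t₀ t₁, N *ᵥ z' t = -((1 - μ • N) *ᵥ z t)) :
    ∀ t ∈ Icc t₀ t₁, (D * N) *ᵥ z t = z t := by
  obtain ⟨ν, hν⟩ := h.pow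
  have hcN : Commute N (1 - D * N) := by
    have : N * (D * N) = D * N * N := by rw [← mul_assoc, ← h.comm]
    exact (Commute.one_right N).sub_right this
  have hsol : ∀ t ∈ Icc t₀ t₁, z t = N *ᵥ (μ • z t - z' t) := by
    intro t ht
    rw [mulVec_sub, hN t ht, sub_mulVec, mulVec_smul, one_mulVec, smul_mulVec]
    abel
  -- The exponent of `N` descends from `ν`, where the Drazin property gives zero, to `0`. Once `(1 -
  -- D N) N ^ (j + 1)` kills `z` on the interval it also kills `z'`, and `z = N (μ z - z')` then
  -- lowers the exponent to `j`.
  have hmain : ∀ k ≤ ν, ∀ t ∈ Icc t₀ t₁, ((1 - D * N) * N ^ (ν - k)) *ᵥ z t = 0 := by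
    intro k
    induction k with
    | zero =>
      intro _ t _
      have : (1 - D * N) * N ^ ν = 0 := by
        rw [sub_mul, one_mul, mul_assoc, ← pow_succ', hν, sub_self]
      rw [Nat.sub_zero, this, zero_mulVec]
    | succ k ih =>
      intro hk t htm
      have ih := ih (by omega)
      have hpow : N ^ (ν - (k + 1)) * N = N ^ (ν - k) := by
        rw [← pow_succ]; congr 1; omega
      have hd : ((1 - D * N) * N ^ (ν - k)) *ᵥ z' t = 0 := by
        have h1 := (hz t htm).matrix_mulVec ((1 - D * N) * N ^ (ν - k))
        have h2 : HasDerivWithinAt (fun r => ((1 - D * N) * N ^ (ν - k)) *ᵥ z r) 0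
            (Icc t₀ t₁) t :=
          (hasDerivWithinAt_const t _ (0 : ι → 𝕜)).congr ih (ih t htm)
        exact (uniqueDiffOn_Icc ht t htm).eq_deriv _ h1 h2
      rw [hsol t htm, mulVec_mulVec, mul_assoc, hpow, mulVec_sub, mulVec_smul, ih t htm, hd]
      simp
  intro t htm
  have := hmain ν le_rfl t htm
  rw [Nat.sub_self, pow_zero, mul_one, sub_mulVec, one_mulVec] at this
  exact (sub_eq_zero.1 this).symm

/-- Drazin inverse solution formula for the linear DAE `N z' = -(1 - μ N) z`. -/
theorem IsDrazinInverse.solution_iff (h : IsDrazinInverse N D) (ht : t₀ < t₁)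
    (hz : ∀ t ∈ Icc t₀ t₁, HasDerivWithinAt z (z' t) (Icc t₀ t₁) t) :
    (∀ t ∈ Icc t₀ t₁, N *ᵥ z' t = -((1 - μ • N) *ᵥ z t)) ↔
      (∀ t ∈ Icc t₀ t₁, (D * N) *ᵥ z t = z t ∧ z' t = (-(D * (1 - μ • N))) *ᵥ z t) := by
  refine ⟨fun hN => ?_, fun hN t htm => ?_⟩
  · have hP := h.mulVec_eq_self_of_solution ht hz hN
    refine fun t htm => ⟨hP t htm, ?_⟩
    -- Differentiate `D N z = z`; one-sided derivatives are unique since `t₀ < t₁`.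
    have hP' : (D * N) *ᵥ z' t = z' t :=
      (uniqueDiffOn_Icc ht t htm).eq_deriv _ ((hz t htm).matrix_mulVec (D * N))
        ((hz t htm).congr hP (hP t htm))
    rw [← hP', ← mulVec_mulVec, hN t htm, mulVec_neg, mulVec_mulVec, neg_mulVec]
  · rw [(hN t htm).2]
    exact h.mulVec_slope μ (hN t htm).1

/-- The differential form of the solution set agrees with its exponential form. -/
theorem IsDrazinInverse.slope_iff_exp (h : IsDrazinInverse N D) (ht : t₀ < t₁)
    (hz : ∀ t ∈ Icc t₀ t₁, HasDerivWithinAt z (z' t) (Icc t₀ t₁) t) :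
    (∀ t ∈ Icc t₀ t₁, (D * N) *ᵥ z t = z t ∧ z' t = (-(D * (1 - μ • N))) *ᵥ z t) ↔
      (D * N) *ᵥ z t₀ = z t₀ ∧ ∀ t ∈ Icc t₀ t₁,
        z t = NormedSpace.exp (((t - t₀ : ℝ) : 𝕜) • (-(D * (1 - μ • N)))) *ᵥ z t₀ := by
  constructor
  · intro hs
    refine ⟨(hs t₀ (left_mem_Icc.2 ht.le)).1, eq_exp_smul_mulVec_of_hasDerivWithinAt _ ?_⟩
    intro t htm
    rw [← (hs t htm).2]
    exact hz t htm
  · rintro ⟨h0, hexp⟩ t htm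
    have hc : Commute (D * N) (-(D * (1 - μ • N))) := by
      have hDN : Commute D N := h.comm
      have h1 : Commute (D * N) N := hDN.mul_left (Commute.refl N)
      have h2 : Commute (D * N) D := (Commute.refl D).mul_left hDN.symm
      exact (h2.mul_right ((Commute.one_right _).sub_right (h1.smul_right μ))).neg_right
    constructor
    -- The generator commutes with `D N`, so its flow preserves the range of this projection.
    · have hce : Commute (D * N)
          (NormedSpace.exp (((t - t₀ : ℝ) : 𝕜) • (-(D * (1 - μ • N))))) :=
        Commute.exp_right (hc.smul_right _)
      rw [hexp t htm, mulVec_mulVec, hce.eq, ← mulVec_mulVec, h0]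
    · refine (uniqueDiffOn_Icc ht t htm).eq_deriv _ (hz t htm) ?_
      have h1 := (hasDerivAt_exp_smul_mulVec (-(D * (1 - μ • N))) (z t₀) t₀ t).hasDerivWithinAt
        (s := Icc t₀ t₁)
      rw [← hexp t htm] at h1
      exact h1.congr hexp (hexp t htm)

end

/-- The end points are interior to the larger interval, so the extension is differentiable there
too. -/
theorem IsC1OnInterval.hasDerivWithinAt {F : Type*} [NormedAddCommGroup F] [NormedSpace ℝ F]
    {t₀ t₁ : ℝ} {f : ℝ → F} (h : IsC1OnInterval t₀ t₁ f) :
    ∃ f' : ℝ → F, ∀ t ∈ Icc t₀ t₁, HasDerivWithinAt f (f' t) (Icc t₀ t₁) t := by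
  obtain ⟨ε, hε, g, hg, hfg⟩ := h
  refine ⟨deriv g, fun t ht => ?_⟩
  have hd : DifferentiableAt ℝ g t :=
    (hg.differentiableOn one_ne_zero).differentiableAt
      (Ioo_mem_nhds (by linarith [ht.1]) (by linarith [ht.2]))
  exact hd.hasDerivAt.hasDerivWithinAt.congr hfg (hfg ht)

/-! ### Reduction of the optimality DAE to the matrices `N_μ` and `M_μ` -/

namespace OptimalityDAE

section

variable {𝕜 : Type*} [RCLike 𝕜] {n m : ℕ} {J R Q : Matrix (Fin n) (Fin n) 𝕜}
  {B : Matrix (Fin n) (Fin m) 𝕜} {S : Matrix (Fin m) (Fin m) 𝕜} {μ : 𝕜}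

/-- The matrix inverted in the definition of `E_μ` is invertible. -/
theorem isUnit_shifted (hμ₁ : μ ∉ spectrum 𝕜 ((J - R) * Q))
    (hμ₂ : μ ∉ spectrum 𝕜 (-((J - R) * Q)ᴴ)) :
    IsUnit (fromBlocks 0 ((J - R) * Q - μ • 1) (((J - R) * Q)ᴴ + μ • 1) (Q * R * Q)) := by
  rw [spectrum.notMem_iff, Algebra.algebraMap_eq_smul_one] at hμ₁ hμ₂
  refine isUnit_fromBlocks_zero₁₁ _ ?_ ?_
  · rw [← neg_sub]
    exact hμ₁.neg
  · rwa [sub_neg_eq_add, add_comm] at hμ₂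

/-- Exhibits the blocks whose Schur complement is `S_μ`. -/
theorem calA_sub_smul_calE :
    calA J R Q B S - μ • calE 𝕜 n m =
      fromBlocks (fromBlocks 0 ((J - R) * Q - μ • 1) (((J - R) * Q)ᴴ + μ • 1) (Q * R * Q))
        (fromRows B 0) (fromCols Bᴴ 0) S := by
  simp [calA, calE, sub_eq_add_neg, fromBlocks_smul, fromBlocks_neg, fromBlocks_add]

/-- The Schur complement `S_μ` is invertible. -/
theorem isUnit_Smu (hμ₁ : μ ∉ spectrum 𝕜 ((J - R) * Q))
    (hμ₂ : μ ∉ spectrum 𝕜 (-((J - R) * Q)ᴴ))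
    (hμ₃ : IsUnit (μ • calE 𝕜 n m - calA J R Q B S)) : IsUnit (Smu J R Q B S μ) := by
  have hK := hμ₃.neg
  rw [neg_sub, calA_sub_smul_calE] at hK
  let := (isUnit_shifted hμ₁ hμ₂).invertible
  rw [isUnit_fromBlocks_iff_of_invertible₁₁, invOf_eq_nonsing_inv] at hK
  exact hK

/-- Pointwise form of the optimality DAE, solved for the state `z = (λ, x)` and the input `u`
in terms of the derivative `v` of the state. -/
theorem calE_mulVec_eq_calA_mulVec_iff (hμ₁ : μ ∉ spectrum 𝕜 ((J - R) * Q))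
    (hμ₂ : μ ∉ spectrum 𝕜 (-((J - R) * Q)ᴴ))
    (hμ₃ : IsUnit (μ • calE 𝕜 n m - calA J R Q B S))
    (z v : Fin n ⊕ Fin n → 𝕜) (u u' : Fin m → 𝕜) :
    calE 𝕜 n m *ᵥ Sum.elim v u' = calA J R Q B S *ᵥ Sum.elim z u ↔
      Nmu J R Q B S μ *ᵥ v = -((1 - μ • Nmu J R Q B S μ) *ᵥ z) ∧
        u = Mmu J R Q B S μ *ᵥ (μ • z - v) := by
  have hblock := blockSystem_iff (fromRows B 0) (fromCols Bᴴ 0) S (isUnit_shifted hμ₁ hμ₂)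
    (isUnit_Smu hμ₁ hμ₂ hμ₃) z ((fromBlocks 0 1 (-1) 0 : Matrix _ _ 𝕜) *ᵥ (v - μ • z)) u
  have hleft : calE 𝕜 n m *ᵥ Sum.elim v u' = calA J R Q B S *ᵥ Sum.elim z u ↔
      (calA J R Q B S - μ • calE 𝕜 n m) *ᵥ Sum.elim z u =
        Sum.elim ((fromBlocks 0 1 (-1) 0 : Matrix _ _ 𝕜) *ᵥ (v - μ • z)) 0 := by
    have hE : ∀ (y : Fin n ⊕ Fin n → 𝕜) (w : Fin m → 𝕜), calE 𝕜 n m *ᵥ Sum.elim y w =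
        Sum.elim ((fromBlocks 0 1 (-1) 0 : Matrix _ _ 𝕜) *ᵥ y) 0 := by
      intro y w
      rw [calE, fromBlocks_mulVec]
      simp
    have hsub : Sum.elim ((fromBlocks 0 1 (-1) 0 : Matrix _ _ 𝕜) *ᵥ (v - μ • z)) 0 =
        calE 𝕜 n m *ᵥ Sum.elim v u' - μ • calE 𝕜 n m *ᵥ Sum.elim z u := by
      rw [hE, hE, mulVec_sub, mulVec_smul]
      ext (i | i) <;> simp
    rw [hsub, sub_mulVec, smul_mulVec, sub_left_inj]
    exact eq_comm
  -- This sign turns `v - μ • z` into `μ • z - v`, matching `Nmu` and `Mmu`.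
  have hswap : (fromBlocks 0 1 (-1) 0 : Matrix (Fin n ⊕ Fin n) (Fin n ⊕ Fin n) 𝕜) =
      -fromBlocks 0 (-1) 1 0 := by
    simp [fromBlocks_neg]
  rw [hleft, calA_sub_smul_calE, fromBlocks_mulVec, Sum.elim_eq_iff, Sum.elim_comp_inl,
    Sum.elim_comp_inr, hblock, hswap, neg_mulVec, ← mulVec_neg, neg_sub, mulVec_mulVec,
    mulVec_mulVec]
  refine and_congr ?_ ?_
  · change z = Nmu J R Q B S μ *ᵥ (μ • z - v) ↔ _
    rw [mulVec_sub, mulVec_smul, sub_mulVec, one_mulVec, smul_mulVec, neg_sub, eq_sub_iff_add_eq,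
      eq_sub_iff_add_eq', eq_comm, add_comm, eq_comm]
  · rw [← neg_mulVec]
    rfl

end

end OptimalityDAE

theorem mainTheorem9 {𝕜 : Type*} [RCLike 𝕜] {n m : ℕ}
    (J R Q : Matrix (Fin n) (Fin n) 𝕜) (B : Matrix (Fin n) (Fin m) 𝕜)
    (S : Matrix (Fin m) (Fin m) 𝕜)
    (hpH : OptimalityDAE.IsPortHamiltonian J R Q B) (hS : S.PosSemidef)
    (hreg : IsRegularPencil (OptimalityDAE.calE 𝕜 n m) (OptimalityDAE.calA J R Q B S))
    (μ : 𝕜) (hμ₁ : μ ∉ spectrum 𝕜 ((J - R) * Q)) (hμ₂ : μ ∉ spectrum 𝕜 (-((J - R) * Q)ᴴ))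
    (hμ₃ : IsUnit (μ • OptimalityDAE.calE 𝕜 n m - OptimalityDAE.calA J R Q B S))
    (t₀ t₁ : ℝ) (ht : t₀ < t₁)
    (lam x : ℝ → Fin n → 𝕜) (u : ℝ → Fin m → 𝕜)
    (hC1 : IsC1OnInterval t₀ t₁ (fun t => Sum.elim (Sum.elim (lam t) (x t)) (u t))) :
    IsDAESolution (OptimalityDAE.calE 𝕜 n m) (OptimalityDAE.calA J R Q B S) t₀ t₁
        (fun t => Sum.elim (Sum.elim (lam t) (x t)) (u t)) ↔
      Sum.elim (lam t₀) (x t₀) ∈ LinearMap.range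
          (drazinInverse (OptimalityDAE.Nmu J R Q B S μ) *
            OptimalityDAE.Nmu J R Q B S μ).mulVecLin ∧
      (∀ t ∈ Set.Icc t₀ t₁, Sum.elim (lam t) (x t) =
        NormedSpace.exp (((t - t₀ : ℝ) : 𝕜) •
          (-(drazinInverse (OptimalityDAE.Nmu J R Q B S μ) *
            (1 - μ • OptimalityDAE.Nmu J R Q B S μ)))) *ᵥ Sum.elim (lam t₀) (x t₀)) ∧
      (∀ t ∈ Set.Icc t₀ t₁, u t =
        (OptimalityDAE.Mmu J R Q B S μ * drazinInverse (OptimalityDAE.Nmu J R Q B S μ)) *ᵥ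
          Sum.elim (lam t) (x t)) := by
  have hD := isDrazinInverse_drazinInverse (OptimalityDAE.Nmu J R Q B S μ)
  set N := OptimalityDAE.Nmu J R Q B S μ
  set D := drazinInverse N
  obtain ⟨f', hf'⟩ := hC1.hasDerivWithinAt
  have hz : ∀ t ∈ Icc t₀ t₁, HasDerivWithinAt (fun t => Sum.elim (lam t) (x t))
      (f' t ∘ Sum.inl) (Icc t₀ t₁) t := fun t htm =>
    hasDerivWithinAt_pi.2 fun i => hasDerivWithinAt_pi.1 (hf' t htm) (Sum.inl i)
  have hDAE : IsDAESolution (OptimalityDAE.calE 𝕜 n m) (OptimalityDAE.calA J R Q B S) t₀ t₁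
        (fun t => Sum.elim (Sum.elim (lam t) (x t)) (u t)) ↔
      ∀ t ∈ Icc t₀ t₁, N *ᵥ (f' t ∘ Sum.inl) = -((1 - μ • N) *ᵥ Sum.elim (lam t) (x t)) ∧
        u t = OptimalityDAE.Mmu J R Q B S μ *ᵥ
          (μ • Sum.elim (lam t) (x t) - f' t ∘ Sum.inl) := by
    -- The last block column of `𝓔` is zero, so the derivative of `u` plays no role.
    refine forall₂_congr fun t htm => ?_
    rw [← OptimalityDAE.calE_mulVec_eq_calA_mulVec_iff hμ₁ hμ₂ hμ₃ _ _ _ (f' t ∘ Sum.inr),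
      Sum.elim_comp_inl_inr]
    have hE := (hf' t htm).matrix_mulVec (OptimalityDAE.calE 𝕜 n m)
    exact ⟨fun h => (uniqueDiffOn_Icc ht t htm).eq_deriv _ hE h, fun h => h ▸ hE⟩
  -- Here `z' = -D z + μ D N z = -D z + μ z`, hence `μ z - z' = D z`.
  have hslope : ∀ t, (D * N) *ᵥ Sum.elim (lam t) (x t) = Sum.elim (lam t) (x t) →
      f' t ∘ Sum.inl = (-(D * (1 - μ • N))) *ᵥ Sum.elim (lam t) (x t) →
      OptimalityDAE.Mmu J R Q B S μ *ᵥ (μ • Sum.elim (lam t) (x t) - f' t ∘ Sum.inl) =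
        (OptimalityDAE.Mmu J R Q B S μ * D) *ᵥ Sum.elim (lam t) (x t) := by
    intro t h1 h2
    rw [h2, ← mulVec_mulVec, neg_mulVec, mul_sub, mul_one, mul_smul_comm, sub_mulVec,
      smul_mulVec, h1]
    congr 1
    abel
  rw [hDAE, hD.mem_range_iff, forall₂_and, hD.solution_iff ht hz, ← and_assoc,
    ← hD.slope_iff_exp ht hz]
  -- The two formulas for `u` agree only once `z` is known to satisfy the state equations.
  refine and_congr_right fun hs => forall₂_congr fun t htm => ?_
  rw [hslope t (hs t htm).1 (hs t htm).2]
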